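/- **Setting.** A *computation states structure* $(L,\mathcal P)$ is a set $L$ of states with a (possibly uncountable) family $\mathcal P$ of real-valued functions (features) on $L$ such that $\operatorname{tp}(v)=(P(v))_{P\in\mathcal P}\in\mathbb R^{\mathcal P}$ determines $v$; $L$ is identified with $\operatorname{tp}[L]\subseteq\mathbb R^{\mathcal P}$ (product topology), and $\mathcal L$ denotes its closure. A *sizer* is a family $r_\bullet=(r_P)_{P\in\mathcal P}$ of positive reals; its *shard* is $L[r_\bullet]=\{v\in L: |P(v)|\le r_P \text{ for all } P\}$, its *type-shard* is $\mathcal L[r_\bullet]=\overline{L[r_\bullet]}$ (closure in $\mathbb R^{\mathcal P}$), and $\mathcal L_{\rm sh}=\bigcup_{r_\bullet}\mathcal L[r_\bullet]$ is the space of *shard-supported types*. A *CCS* $(L,\mathcal P,\Gamma)$ is such a structure with a set $\Gamma\subseteq L^L$ that contains the identity and is closed under composition. It satisfies the *Extendibility Axiom* if every $\gamma\in\Gamma$ extends to a map $\tilde\gamma:\mathcal L_{\rm sh}\to\mathcal L_{\rm sh}$ such that for every sizer $r_\bullet$ there is a sizer $s_\bullet$ for which $\tilde\gamma$ restricts to a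 continuous map $\mathcal L[r_\bullet]\to\mathcal L[s_\bullet]$. A set $R$ of sizers is *exhaustive* if $L=\bigcup_{r_\bullet\in R}L[r_\bullet]$, and *cofinal* if every shard of $L$ is contained in $L[r_\bullet]$ for some $r_\bullet\in R$. A set $\Delta\subseteq\Gamma$ is *$R$-confined* if $\gamma(L[r_\bullet])\subseteq L[r_\bullet]$ for all $\gamma\in\Delta$, $r_\bullet\in R$. A *deep computation of $\Delta$* is an element of the closure of $\Delta$ in the product space $\mathcal L^L$. A set $A$ of real functions on a set $X$ has *NIP* if for every sequence $(f_n)_{n\in\mathbb N}$ in $A$ and reals $a<b$ there are disjoint finite $E,F\subseteq\mathbb N$ such that no $x\in X$ satisfies $f_n(x)\le a$ for all $n\in E$ and $f_n(x)\ge b$ for all $n\in F$. A map $f:L\to\mathcal L$ is *universally Monte Carlo computable on $R$* if it extends to a map $\tilde f:\mathcal L_{\rm sh}\to\mathcal L_{\rm sh}$ such that for every $r_\bullet\in R$ there is a sizer $s_\bullet$ with $\tilde f(\mathcal L[r_\bullet])\subseteq\mathcal L[s_\bullet]$ and such that, for every $P\in\mathcal P$, the function $\pi_P\circ\tilde f|_{\mathcal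 L[r_\bullet]}$ is $\mu$-measurable for every Radon probability measure $\mu$ on $\mathcal L[r_\bullet]$. It is *universally Monte Carlo computable* if this holds with $R$ the set of all sizers. **Theorem.** Let $(L,\mathcal P,\Gamma)$ be a CCS satisfying the Extendibility Axiom, let $R$ be an exhaustive collection of sizers, and let $\Delta\subseteq\Gamma$ be $R$-confined. Suppose that for all $P\in\mathcal P$ and all $r_\bullet\in R$ the set $\{P\circ\gamma|_{L[r_\bullet]}:\gamma\in\Delta\}$ of real functions on $L[r_\bullet]$ has NIP. Then every deep computation of $\Delta$ is universally Monte Carlo computable on $R$. If moreover $R$ is cofinal, then every deep computation of $\Delta$ is universally Monte Carlo computable. -/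

import Mathlib

open Set Topology MeasureTheory

universe u v

/-- Finitary No-Independence Property of a collection `A` of real-valued functions on `X`. -/
def HasNIP {X : Type*} (A : Set (X → ℝ)) : Prop :=
  ∀ f : ℕ → X → ℝ, (∀ n, f n ∈ A) → ∀ a b : ℝ, a < b →
    ∃ E F : Finset ℕ, Disjoint E F ∧
      {x : X | (∀ n ∈ E, f n x ≤ a) ∧ (∀ n ∈ F, b ≤ f n x)} = ∅

/-- `g` is measurable for (the completion of) every Radon probability measure on `X`. Here `X`
carries its Borel σ-algebra, and a probability measure on it is Radon when it is inner regular
with respect to compact sets. The Borel σ-algebra is quantified explicitly because on subsets of an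
uncountable product `𝔓 → ℝ` it is larger than the default (cylinder) σ-algebra. -/
def UniversallyMeasurable {X Y : Type*} [TopologicalSpace X] [MeasurableSpace Y]
    (g : X → Y) : Prop :=
  ∀ (_ : MeasurableSpace X) (_ : BorelSpace X) (μ : Measure X),
    IsProbabilityMeasure μ → μ.InnerRegular → NullMeasurable g μ

/-- A sizer: a family of positive reals indexed by the predicates. -/
abbrev Sizer (𝔓 : Type v) : Type v := {r : 𝔓 → ℝ // ∀ P, 0 < r P}

/-- A computation states structure: states `L`, with real-valued predicates (features) named by the
elements of `𝔓`, such that every state is determined by its type. -/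
structure ComputationStates (L : Type u) (𝔓 : Type v) where
  /-- the value `P(v)` of the feature `P` at the state `v` -/
  pred : 𝔓 → L → ℝ
  /-- a state is determined by its type -/
  separates : Function.Injective fun (v : L) (P : 𝔓) => pred P v

namespace ComputationStates

variable {L : Type u} {𝔓 : Type v} (S : ComputationStates L 𝔓)

/-- The type of a state. -/
def tp (v : L) : 𝔓 → ℝ := fun P => S.pred P v

/-- The space `𝓛` of state types: the closure of the set of realized types in `ℝ^𝔓`. -/
def typeSpace : Set (𝔓 → ℝ) := closure (range S.tp)

/-- The shard `L[r]` of the state space. -/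
def shard (r : Sizer 𝔓) : Set L := {v | ∀ P, |S.pred P v| ≤ r.1 P}

/-- The type-shard `𝓛[r]`: the closure of (the types of the states in) `L[r]` in `ℝ^𝔓`. -/
def typeShard (r : Sizer 𝔓) : Set (𝔓 → ℝ) := closure (S.tp '' S.shard r)

/-- The space `𝓛_sh` of shard-supported types. -/
def shardTypes : Set (𝔓 → ℝ) := ⋃ r : Sizer 𝔓, S.typeShard r

theorem tp_mem_typeSpace (v : L) : S.tp v ∈ S.typeSpace :=
  subset_closure (mem_range_self v)

theorem typeShard_subset_shardTypes (r : Sizer 𝔓) : S.typeShard r ⊆ S.shardTypes :=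
  subset_iUnion S.typeShard r

theorem tp_mem_shardTypes (v : L) : S.tp v ∈ S.shardTypes :=
  S.typeShard_subset_shardTypes
    ⟨fun P => |S.pred P v| + 1, fun P => by positivity⟩
    (subset_closure (mem_image_of_mem S.tp fun P => by simp))

/-- A state, seen as an element of `𝓛`. -/
def toType (v : L) : S.typeSpace := ⟨S.tp v, S.tp_mem_typeSpace v⟩

/-- A state, seen as an element of `𝓛_sh`. -/
def toShardType (v : L) : S.shardTypes := ⟨S.tp v, S.tp_mem_shardTypes v⟩

/-- A collection of sizers is exhaustive if its shards cover `L`. -/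
def Exhaustive (R : Set (Sizer 𝔓)) : Prop := ⋃ r ∈ R, S.shard r = univ

/-- A collection of sizers is cofinal if every shard of `L` is contained in one of its shards. -/
def Cofinal (R : Set (Sizer 𝔓)) : Prop := ∀ r : Sizer 𝔓, ∃ r' ∈ R, S.shard r ⊆ S.shard r'

/-- `Δ` is `R`-confined: each `γ ∈ Δ` maps each shard `L[r]`, `r ∈ R`, into itself. -/
def Confined (R : Set (Sizer 𝔓)) (Δ : Set (L → L)) : Prop :=
  ∀ γ ∈ Δ, ∀ r ∈ R, MapsTo γ (S.shard r) (S.shard r)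

/-- A transition `γ` is extendable: it extends to a map `𝓛_sh → 𝓛_sh` that restricts, on each
type-shard, to a continuous map into some type-shard. -/
def Extendable (γ : L → L) : Prop :=
  ∃ γ' : S.shardTypes → S.shardTypes,
    (∀ v, γ' (S.toShardType v) = S.toShardType (γ v)) ∧
    ∀ r : Sizer 𝔓, ∃ s : Sizer 𝔓,
      (∀ x : S.shardTypes, x.1 ∈ S.typeShard r → (γ' x).1 ∈ S.typeShard s) ∧
      ContinuousOn γ' {x | x.1 ∈ S.typeShard r}

/-- The collection `π_P ∘ Δ|_{L[r]}` of real-valued functions on `L[r]`. -/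
def featureFamily (Δ : Set (L → L)) (P : 𝔓) (r : Sizer 𝔓) : Set (S.shard r → ℝ) :=
  (fun (γ : L → L) (v : S.shard r) => S.pred P (γ v)) '' Δ

/-- The deep computations of `Δ`: the closure of `Δ` in the product space `𝓛^L`. -/
def deepComputations (Δ : Set (L → L)) : Set (L → S.typeSpace) :=
  closure ((fun (γ : L → L) (v : L) => S.toType (γ v)) '' Δ)

/-- `f : L → 𝓛` is universally Monte Carlo computable on the type-shards of the sizers in `R`: it
extends to a map `𝓛_sh → 𝓛_sh` that restricts, on the type-shard of each `r ∈ R`, to a map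
into some type-shard all of whose features are universally measurable. -/
def UniversallyMonteCarloComputableOn (R : Set (Sizer 𝔓)) (f : L → S.typeSpace) : Prop :=
  ∃ f' : S.shardTypes → S.shardTypes,
    (∀ v, (f' (S.toShardType v)).1 = (f v).1) ∧
    ∀ r ∈ R, ∃ s : Sizer 𝔓,
      (∀ x : S.shardTypes, x.1 ∈ S.typeShard r → (f' x).1 ∈ S.typeShard s) ∧
      ∀ P : 𝔓, UniversallyMeasurable fun x : S.typeShard r =>
        (f' ⟨x.1, S.typeShard_subset_shardTypes r x.2⟩).1 P

/-- `f : L → 𝓛` is universally Monte Carlo computable: the same for all sizers. -/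
def UniversallyMonteCarloComputable (f : L → S.typeSpace) : Prop :=
  S.UniversallyMonteCarloComputableOn univ f

end ComputationStates

/-- A compositional computation structure: a computation states structure with a monoid `Γ` of
transformations of the state space, the computations. -/
structure CCS (L : Type u) (𝔓 : Type v) extends ComputationStates L 𝔓 where
  /-- the computations -/
  Γ : Set (L → L)
  id_mem : id ∈ Γ
  comp_mem : ∀ γ ∈ Γ, ∀ δ ∈ Γ, γ ∘ δ ∈ Γ

/-- The Extendibility Axiom: every computation is extendable. -/
def CCS.ExtendibilityAxiom {L : Type u} {𝔓 : Type v} (C : CCS L 𝔓) : Prop :=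
  ∀ γ ∈ C.Γ, C.Extendable γ

/-!
The extension of a deep computation `f` is an ultrafilter limit. An ultrafilter on `Δ` along which
the computations converge to `f` on `L` is fixed. By density, the continuous extension of an
`R`-confined computation maps each type-shard of a sizer in `R` into itself, and type-shards are
compact, so the extensions of the computations in `Δ` converge along the same ultrafilter at every
point of these type-shards. The limit agrees with `f` on `L` because the shards from `R` cover `L`.

Each feature of the limit is then, on a type-shard, a pointwise limit of continuous functions whose
restrictions to a dense set form a family with NIP. Such a limit `g` is measurable for every Radon
probability measure `μ` (`nullMeasurable_of_mem_closure_of_hasNIP`), by an argument going back to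
Bourgain, Fremlin and Talagrand. If `g` is not `μ`-measurable, there are `a < b` and a set `H` of
positive measure in which neither `{g ≤ a}` nor `{g ≥ b}` misses a measurable subset of positive
measure (`exists_entangled_of_not_nullMeasurable`). Inner regularity allows the removal of the
`μ`-negligible relatively open part of `H` (`measure_inter_sUnion_null`), so that every open set
meeting the remaining set `S` does so in points of both `{g ≤ a}` and `{g ≥ b}`. Approximating `g`
at finitely many such points, again and again, produces a sequence of continuous functions that is
independent on open sets (`exists_independent_seq`), hence independent on the dense set, against
NIP.

For cofinal `R`, every type-shard is contained in one coming from `R`, and universal measurability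
is inherited along continuous maps, since these push Radon measures forward to Radon measures.
-/

/-! ### Measurability of pointwise limits of families with NIP -/

open Filter in
/-- A function that is not measurable up to null sets oscillates between two levels `a < b`
throughout a set `H` of positive measure, namely the intersection of measurable hulls of `{g ≤ a}`
and `{b ≤ g}`: if all such intersections were null, then `{g ≤ t}` would coincide almost everywhere
with its hull. -/
theorem exists_entangled_of_not_nullMeasurable {X : Type*} [MeasurableSpace X] {μ : Measure X}
    [IsFiniteMeasure μ] {g : X → ℝ} (hg : ¬ NullMeasurable g μ) :
    ∃ a b : ℝ, a < b ∧ ∃ H : Set X, MeasurableSet H ∧ μ H ≠ 0 ∧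
      ∀ B ⊆ H, MeasurableSet B → μ B ≠ 0 →
        (∃ x ∈ B, g x ≤ a) ∧ (∃ x ∈ B, b ≤ g x) := by
  by_cases h : ∀ a b : ℝ, a < b →
      μ (toMeasurable μ {x | g x ≤ a} ∩ toMeasurable μ {x | b ≤ g x}) = 0
  · refine absurd ?_ hg
    have key : ∀ t : ℝ, NullMeasurableSet (g ⁻¹' Iic t) μ := by
      intro t
      refine NullMeasurableSet.congr
        (measurableSet_toMeasurable μ {x | g x ≤ t}).nullMeasurableSet ?_
      refine (EventuallyLE.antisymm (LE.le.eventuallyLE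
        (subset_toMeasurable μ {x | g x ≤ t})) ?_).symm
      rw [ae_le_set]
      refine measure_mono_null (t := ⋃ n : ℕ, toMeasurable μ {x | g x ≤ t} ∩
        toMeasurable μ {x | t + 1 / ((n : ℝ) + 1) ≤ g x}) ?_ ?_
      · rintro x ⟨hx, hxt⟩
        have hlt : 0 < g x - t := by
          have : ¬ g x ≤ t := hxt
          linarith
        obtain ⟨n, hn⟩ := exists_nat_one_div_lt hlt
        exact mem_iUnion.2 ⟨n, hx, subset_toMeasurable μ _ (by
          change _ ≤ g x; linarith)⟩
      · exact measure_iUnion_null fun n => h _ _ (by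
          have : (0 : ℝ) < 1 / ((n : ℝ) + 1) := by positivity
          linarith)
    exact measurable_of_Iic (δ := NullMeasurableSpace X μ) key
  · push Not at h
    obtain ⟨a, b, hab, hH⟩ := h
    refine ⟨a, b, hab, _, (measurableSet_toMeasurable _ _).inter (measurableSet_toMeasurable _ _),
      hH, fun B hB hBm hB0 => ?_⟩
    -- A measurable set inside the hull of `T` has the same measure as its trace on `T`.
    have hull : ∀ T : Set X, B ⊆ toMeasurable μ T → ∃ x ∈ B, x ∈ T := by
      intro T hT
      have h1 : μ (T ∩ B) ≠ 0 := by
        rw [← Measure.measure_toMeasurable_inter hBm (measure_ne_top μ T),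
          inter_eq_right.2 hT]
        exact hB0
      obtain ⟨x, hx⟩ := nonempty_of_measure_ne_zero h1
      exact ⟨x, hx.2, hx.1⟩
    exact ⟨hull _ (hB.trans inter_subset_left), hull _ (hB.trans inter_subset_right)⟩

/-- `τ`-additivity for null sets: an inner regular measure gives measure zero to the trace on `H`
of the union of all open sets with null trace on `H`. -/
theorem measure_inter_sUnion_null {X : Type*} [TopologicalSpace X] [MeasurableSpace X]
    [BorelSpace X] {μ : Measure X} [μ.InnerRegular] {H : Set X} (hH : MeasurableSet H) :
    μ (H ∩ ⋃₀ {V | IsOpen V ∧ μ (H ∩ V) = 0}) = 0 := by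
  by_contra hne
  have hopen : IsOpen (⋃₀ {V | IsOpen V ∧ μ (H ∩ V) = 0}) := isOpen_sUnion fun V hV => hV.1
  obtain ⟨Q, hQ, hQc, hQ0⟩ :=
    (hH.inter hopen.measurableSet).exists_lt_isCompact (pos_iff_ne_zero.2 hne)
  obtain ⟨T, hT, hTf, hQT⟩ := hQc.elim_finite_subcover_image (c := id)
    (fun V hV => hV.1) (sUnion_eq_biUnion ▸ hQ.trans inter_subset_right)
  refine hQ0.ne' (measure_mono_null (t := ⋃ V ∈ T, H ∩ V) ?_ ?_)
  · intro x hx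
    obtain ⟨V, hV, hxV⟩ := mem_iUnion₂.1 (hQT hx)
    exact mem_iUnion₂.2 ⟨V, hV, (hQ hx).1, hxV⟩
  · exact (measure_biUnion_null_iff hTf.countable).2 fun V hV => (hT hV).2

/-- If every open set meeting `S` does so both in points with `g ≤ a` and in points with `b ≤ g`,
then continuous functions approximating `g` pointwise contain a sequence whose strict lower and
upper level sets are independent. -/
theorem exists_independent_seq {X : Type*} [TopologicalSpace X] {A : Set (X → ℝ)}
    (hA : ∀ f ∈ A, Continuous f) {g : X → ℝ} (hg : g ∈ closure A) {S : Set X} (hS : S.Nonempty)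
    {a a' b' b : ℝ} (ha : a < a') (hb : b' < b)
    (hlow : ∀ V, IsOpen V → (V ∩ S).Nonempty → ∃ x ∈ V ∩ S, g x ≤ a)
    (hupp : ∀ V, IsOpen V → (V ∩ S).Nonempty → ∃ x ∈ V ∩ S, b ≤ g x) :
    ∃ f : ℕ → X → ℝ, (∀ n, f n ∈ A) ∧ ∀ (σ : Set ℕ) (n : ℕ), ∃ V : Set X, IsOpen V ∧
      V.Nonempty ∧ ∀ x ∈ V, ∀ i < n, (i ∈ σ → f i x < a') ∧ (i ∉ σ → b' < f i x) := by
  -- A stage of the construction is a finite family of open sets meeting `S`; the next function has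
  -- to split all of them.
  let Stage := {W : Set (Set X) // W.Finite ∧ ∀ V ∈ W, IsOpen V ∧ (V ∩ S).Nonempty}
  have split : ∀ W : Stage, ∃ f ∈ A, ∀ V ∈ W.1,
      (V ∩ {x | f x < a'} ∩ S).Nonempty ∧ (V ∩ {x | b' < f x} ∩ S).Nonempty := by
    rintro ⟨W, hWf, hW⟩
    have : Nonempty X := hS.nonempty
    choose! p hp hpa using fun V hV => hlow V (hW V hV).1 (hW V hV).2
    choose! q hq hqb using fun V hV => hupp V (hW V hV).1 (hW V hV).2
    have hopen : IsOpen (⋂ V ∈ W, {f : X → ℝ | f (p V) < a' ∧ b' < f (q V)}) :=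
      hWf.isOpen_biInter fun V _ =>
        (isOpen_lt (continuous_apply (p V)) continuous_const).inter
          (isOpen_lt continuous_const (continuous_apply (q V)))
    obtain ⟨f, hf, hfA⟩ := mem_closure_iff.1 hg _ hopen (mem_iInter₂.2 fun V hV =>
      ⟨(hpa V hV).trans_lt ha, hb.trans_le (hqb V hV)⟩)
    refine ⟨f, hfA, fun V hV => ?_⟩
    have := mem_iInter₂.1 hf V hV
    exact ⟨⟨p V, ⟨(hp V hV).1, this.1⟩, (hp V hV).2⟩, ⟨q V, ⟨(hq V hV).1, this.2⟩, (hq V hV).2⟩⟩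
  choose φ hφA hφ using split
  let next : Stage → Stage := fun W =>
    ⟨(fun V => V ∩ {x | φ W x < a'}) '' W.1 ∪ (fun V => V ∩ {x | b' < φ W x}) '' W.1,
      (W.2.1.image _).union (W.2.1.image _), by
        have hc := hA _ (hφA W)
        rintro _ (⟨V, hV, rfl⟩ | ⟨V, hV, rfl⟩)
        · exact ⟨(W.2.2 V hV).1.inter (isOpen_lt hc continuous_const), (hφ W V hV).1⟩
        · exact ⟨(W.2.2 V hV).1.inter (isOpen_lt continuous_const hc), (hφ W V hV).2⟩⟩
  let init : Stage := ⟨{univ}, finite_singleton _, by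
    rintro V rfl
    exact ⟨isOpen_univ, by simpa using hS⟩⟩
  let stage : ℕ → Stage := fun n => next^[n] init
  refine ⟨fun n => φ (stage n), fun n => hφA _, fun σ n => ?_⟩
  suffices h : ∃ V ∈ (stage n).1, ∀ x ∈ V, ∀ i < n,
      (i ∈ σ → φ (stage i) x < a') ∧ (i ∉ σ → b' < φ (stage i) x) by
    obtain ⟨V, hV, h⟩ := h
    exact ⟨V, ((stage n).2.2 V hV).1, ((stage n).2.2 V hV).2.mono inter_subset_left, h⟩
  induction n with
  | zero => exact ⟨univ, rfl, fun x _ i hi => absurd hi (Nat.not_lt_zero i)⟩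
  | succ n ih =>
    obtain ⟨V, hV, h⟩ := ih
    have hstage : stage (n + 1) = next (stage n) := Function.iterate_succ_apply' next n init
    rw [hstage]
    by_cases hn : n ∈ σ
    · refine ⟨_, Or.inl ⟨V, hV, rfl⟩, fun x hx i hi => ?_⟩
      rcases Nat.lt_succ_iff_lt_or_eq.1 hi with hi | rfl
      · exact h x hx.1 i hi
      · exact ⟨fun _ => hx.2, fun h => absurd hn h⟩
    · refine ⟨_, Or.inr ⟨V, hV, rfl⟩, fun x hx i hi => ?_⟩
      rcases Nat.lt_succ_iff_lt_or_eq.1 hi with hi | rfl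
      · exact h x hx.1 i hi
      · exact ⟨fun h => absurd h hn, fun _ => hx.2⟩

/-- A pointwise limit of continuous functions whose restrictions to a dense set form a family with
NIP is measurable for every inner regular finite measure. -/
theorem nullMeasurable_of_mem_closure_of_hasNIP {X Y : Type*} [TopologicalSpace X]
    [MeasurableSpace X] [BorelSpace X] {μ : Measure X} [IsFiniteMeasure μ] [μ.InnerRegular]
    {e : Y → X} (he : DenseRange e) {A : Set (X → ℝ)} (hA : ∀ f ∈ A, Continuous f)
    (hNIP : HasNIP ((fun f : X → ℝ => f ∘ e) '' A)) {g : X → ℝ} (hg : g ∈ closure A) :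
    NullMeasurable g μ := by
  by_contra hmeas
  obtain ⟨a, b, hab, H, hH, hH0, hent⟩ := exists_entangled_of_not_nullMeasurable hmeas
  set N : Set X := ⋃₀ {V | IsOpen V ∧ μ (H ∩ V) = 0}
  have hNopen : IsOpen N := isOpen_sUnion fun V hV => hV.1
  have hN0 : μ (H ∩ N) = 0 := measure_inter_sUnion_null hH
  have hpos : ∀ V, IsOpen V → (V ∩ (H \ N)).Nonempty → μ (V ∩ (H \ N)) ≠ 0 := by
    rintro V hV ⟨x, hxV, -, hxN⟩ h0
    refine hxN (mem_sUnion.2 ⟨V, ⟨hV, measure_mono_null (t := V ∩ (H \ N) ∪ H ∩ N) ?_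
      (measure_union_null h0 hN0)⟩, hxV⟩)
    rintro y ⟨hyH, hyV⟩
    by_cases hy : y ∈ N
    · exact Or.inr ⟨hyH, hy⟩
    · exact Or.inl ⟨hyV, hyH, hy⟩
  have hne : (H \ N).Nonempty := by
    refine nonempty_of_measure_ne_zero (μ := μ) fun h0 => hH0 ?_
    rw [← sdiff_union_inter H N]
    exact measure_union_null h0 hN0
  have hent' := fun V (hV : IsOpen V) (h : (V ∩ (H \ N)).Nonempty) =>
    hent (V ∩ (H \ N)) (inter_subset_right.trans sdiff_subset)
      (hV.measurableSet.inter (hH.diff hNopen.measurableSet)) (hpos V hV h)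
  -- Strictly between `a` and `b` there is room for `a' < b'`, as independence has to be strict.
  obtain ⟨a', haa', ha'b⟩ := exists_between hab
  obtain ⟨b', ha'b', hb'b⟩ := exists_between ha'b
  obtain ⟨f, hfA, hf⟩ := exists_independent_seq hA hg hne haa' hb'b
    (fun V hV h => (hent' V hV h).1) (fun V hV h => (hent' V hV h).2)
  obtain ⟨E, F, hEF, hempty⟩ := hNIP (fun n => f n ∘ e) (fun n => mem_image_of_mem _ (hfA n))
    a' b' ha'b'
  obtain ⟨n, hn⟩ := (E ∪ F).exists_nat_subset_range
  obtain ⟨V, hVo, hVne, hV⟩ := hf E n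
  obtain ⟨y, hy⟩ := he.exists_mem_open hVo hVne
  refine (eq_empty_iff_forall_notMem.1 hempty) y ⟨fun i hi => ?_, fun i hi => ?_⟩
  · exact ((hV _ hy i (Finset.mem_range.1 (hn (Finset.mem_union_left _ hi)))).1 hi).le
  · exact ((hV _ hy i (Finset.mem_range.1 (hn (Finset.mem_union_right _ hi)))).2
      fun h => Finset.disjoint_left.1 hEF h hi).le

theorem UniversallyMeasurable.comp_continuous {X Y Z : Type*} [TopologicalSpace X]
    [TopologicalSpace Y] [MeasurableSpace Z] {g : Y → Z} (hg : UniversallyMeasurable g)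
    {j : X → Y} (hj : Continuous j) : UniversallyMeasurable (g ∘ j) := by
  intro mX bX μ hμ hreg
  let _ : MeasurableSpace Y := borel Y
  have : BorelSpace Y := ⟨rfl⟩
  have hnull := hg inferInstance inferInstance (μ.map j)
    (Measure.isProbabilityMeasure_map hj.aemeasurable) (Measure.InnerRegular.map_of_continuous hj)
  intro s hs
  exact (hnull hs).preimage (hj.measurable.quasiMeasurePreserving μ)

/-! ### Type-shards and extensions of computations -/

namespace ComputationStates

variable {L : Type u} {𝔓 : Type v} (S : ComputationStates L 𝔓)

theorem isCompact_typeShard (r : Sizer 𝔓) : IsCompact (S.typeShard r) := by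
  have hbox : IsCompact (univ.pi fun P => Icc (-r.1 P) (r.1 P)) :=
    isCompact_univ_pi fun P => isCompact_Icc
  refine hbox.of_isClosed_subset isClosed_closure (closure_minimal ?_ hbox.isClosed)
  rintro _ ⟨v, hv, rfl⟩ P -
  exact abs_le.1 (hv P)

/-- A state of a shard, seen as an element of the type-shard. -/
def shardToTypeShard (r : Sizer 𝔓) (v : S.shard r) : S.typeShard r :=
  ⟨S.tp v.1, subset_closure (mem_image_of_mem S.tp v.2)⟩

theorem denseRange_shardToTypeShard (r : Sizer 𝔓) : DenseRange (S.shardToTypeShard r) := by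
  intro x
  rw [closure_subtype]
  have : Subtype.val '' range (S.shardToTypeShard r) = S.tp '' S.shard r := by
    rw [← range_comp, image_eq_range]
    rfl
  rw [this]
  exact x.2

variable {S}

theorem continuous_restrict_typeShard {γ' : S.shardTypes → S.shardTypes} {r : Sizer 𝔓}
    (hγ' : ContinuousOn γ' {x | x.1 ∈ S.typeShard r}) :
    Continuous fun x : S.typeShard r =>
      (γ' ⟨x.1, S.typeShard_subset_shardTypes r x.2⟩).1 :=
  continuous_subtype_val.comp
    (hγ'.comp_continuous (continuous_subtype_val.subtype_mk _) fun x => x.2)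

/-- An extension of a computation that preserves a shard preserves the type-shard. -/
theorem mem_typeShard_of_mapsTo_shard {γ : L → L} {γ' : S.shardTypes → S.shardTypes}
    (hext : ∀ v, γ' (S.toShardType v) = S.toShardType (γ v)) {r : Sizer 𝔓}
    (hγ : MapsTo γ (S.shard r) (S.shard r))
    (hγ' : ContinuousOn γ' {x | x.1 ∈ S.typeShard r}) (x : S.typeShard r) :
    (γ' ⟨x.1, S.typeShard_subset_shardTypes r x.2⟩).1 ∈ S.typeShard r := by
  refine (S.denseRange_shardToTypeShard r).induction_on
    (p := fun x => (γ' ⟨x.1, S.typeShard_subset_shardTypes r x.2⟩).1 ∈ S.typeShard r) x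
    (isClosed_closure.preimage (continuous_restrict_typeShard hγ')) fun v => ?_
  have : γ' ⟨(S.shardToTypeShard r v).1, S.typeShard_subset_shardTypes r
      (S.shardToTypeShard r v).2⟩ = S.toShardType (γ v.1) := hext v.1
  rw [this]
  exact subset_closure (mem_image_of_mem S.tp (hγ v.2))

open Filter in
theorem universallyMonteCarloComputableOn_of_hasNIP {R : Set (Sizer 𝔓)} (hR : S.Exhaustive R)
    {Δ : Set (L → L)} (hext : ∀ γ ∈ Δ, S.Extendable γ) (hconf : S.Confined R Δ)
    (hNIP : ∀ P : 𝔓, ∀ r ∈ R, HasNIP (S.featureFamily Δ P r)) {f : L → S.typeSpace}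
    (hf : f ∈ S.deepComputations Δ) : S.UniversallyMonteCarloComputableOn R f := by
  choose E hE hEs using fun γ : Δ => hext γ.1 γ.2
  have hcont : ∀ (γ : Δ) (r : Sizer 𝔓), ContinuousOn (E γ) {x | x.1 ∈ S.typeShard r} :=
    fun γ r => (hEs γ r).choose_spec.2
  -- An ultrafilter on `Δ` along which the computations converge to `f`.
  obtain ⟨U, hU⟩ : ∃ U : Ultrafilter Δ,
      Tendsto (fun (γ : Δ) (v : L) => S.toType (γ.1 v)) U (𝓝 f) := by
    have hf' : f ∈ closure (range fun (γ : Δ) (v : L) => S.toType (γ.1 v)) := by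
      rw [deepComputations, image_eq_range] at hf
      exact hf
    have : NeBot (comap (fun (γ : Δ) (v : L) => S.toType (γ.1 v)) (𝓝 f)) :=
      comap_neBot fun t ht => by
        obtain ⟨_, hy, γ, rfl⟩ := mem_closure_iff_nhds.1 hf' t ht
        exact ⟨γ, hy⟩
    exact ⟨Ultrafilter.of _, tendsto_iff_comap.2 (Ultrafilter.of_le _)⟩
  have hlim : ∀ r ∈ R, ∀ x : S.shardTypes, x.1 ∈ S.typeShard r →
      ∃ y ∈ S.typeShard r, Tendsto (fun γ => (E γ x).1) U (𝓝 y) := by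
    intro r hr x hx
    exact (S.isCompact_typeShard r).ultrafilter_le_nhds' (U.map fun γ => (E γ x).1)
      (Ultrafilter.mem_map.2 (univ_mem' fun γ =>
        mem_typeShard_of_mapsTo_shard (hE γ) (hconf γ.1 γ.2 r hr) (hcont γ r) ⟨x.1, hx⟩))
  -- Outside the type-shards from `R` the limit need not exist, and any value will do.
  have htotal : ∀ x : S.shardTypes, ∃ y : S.shardTypes,
      ∀ r ∈ R, x.1 ∈ S.typeShard r → Tendsto (fun γ => (E γ x).1) U (𝓝 y.1) := by
    intro x
    by_cases h : ∃ r ∈ R, x.1 ∈ S.typeShard r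
    · obtain ⟨r, hr, hx⟩ := h
      obtain ⟨y, hy, hxy⟩ := hlim r hr x hx
      exact ⟨⟨y, S.typeShard_subset_shardTypes r hy⟩, fun _ _ _ => hxy⟩
    · exact ⟨x, fun r hr hx => absurd ⟨r, hr, hx⟩ h⟩
  choose f' hf' using htotal
  refine ⟨f', fun v => ?_, fun r hr => ⟨r, fun x hx => ?_, fun P => ?_⟩⟩
  · obtain ⟨r, hr, hv⟩ : ∃ r ∈ R, v ∈ S.shard r := by
      have : v ∈ ⋃ r ∈ R, S.shard r := hR ▸ mem_univ v
      simpa using this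
    have h1 := hf' (S.toShardType v) r hr (S.shardToTypeShard r ⟨v, hv⟩).2
    simp only [hE] at h1
    exact tendsto_nhds_unique h1
      ((continuous_subtype_val.tendsto (f v)).comp (tendsto_pi_nhds.1 hU v))
  · obtain ⟨y, hy, hxy⟩ := hlim r hr x hx
    rwa [tendsto_nhds_unique (hf' x r hr hx) hxy]
  · let A : Set (S.typeShard r → ℝ) := range fun (γ : Δ) (x : S.typeShard r) =>
      (E γ ⟨x.1, S.typeShard_subset_shardTypes r x.2⟩).1 P
    have hA : ∀ h ∈ A, Continuous h := by
      rintro _ ⟨γ, rfl⟩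
      exact (continuous_apply P).comp (continuous_restrict_typeShard (hcont γ r))
    have hAfeature : (fun h : S.typeShard r → ℝ => h ∘ S.shardToTypeShard r) '' A =
        S.featureFamily Δ P r := by
      rw [← range_comp, featureFamily, image_eq_range]
      congr 1
      funext γ v
      exact congrArg (fun y : S.shardTypes => y.1 P) (hE γ v.1)
    intro _ _ μ _ _
    refine nullMeasurable_of_mem_closure_of_hasNIP (S.denseRange_shardToTypeShard r) hA
      (hAfeature ▸ hNIP P r hr) (mem_closure_of_tendsto (b := (U : Filter Δ)) ?_
        (Eventually.of_forall fun γ => mem_range_self γ))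
    exact tendsto_pi_nhds.2 fun x => tendsto_pi_nhds.1
      (hf' ⟨x.1, S.typeShard_subset_shardTypes r x.2⟩ r hr x.2) P

theorem UniversallyMonteCarloComputableOn.of_cofinal {R : Set (Sizer 𝔓)} (hR : S.Cofinal R)
    {f : L → S.typeSpace} (hf : S.UniversallyMonteCarloComputableOn R f) :
    S.UniversallyMonteCarloComputable f := by
  obtain ⟨f', hext, hf'⟩ := hf
  refine ⟨f', hext, fun r _ => ?_⟩
  obtain ⟨r', hr', hsub⟩ := hR r
  have hsub' : S.typeShard r ⊆ S.typeShard r' := closure_mono (image_mono hsub)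
  obtain ⟨s, hs, hmeas⟩ := hf' r' hr'
  exact ⟨s, fun x hx => hs x (hsub' hx), fun P =>
    (hmeas P).comp_continuous (continuous_inclusion hsub')⟩

end ComputationStates

theorem mainTheorem2 {L : Type u} {𝔓 : Type v} (C : CCS L 𝔓) (hC : C.ExtendibilityAxiom)
    (R : Set (Sizer 𝔓)) (hR : C.Exhaustive R)
    (Δ : Set (L → L)) (hΔ : Δ ⊆ C.Γ) (hconf : C.Confined R Δ)
    (hNIP : ∀ P : 𝔓, ∀ r ∈ R, HasNIP (C.featureFamily Δ P r)) :
    ∀ f ∈ C.deepComputations Δ,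
      C.UniversallyMonteCarloComputableOn R f ∧
      (C.Cofinal R → C.UniversallyMonteCarloComputable f) := by
  intro f hf
  have h := ComputationStates.universallyMonteCarloComputableOn_of_hasNIP hR
    (fun γ hγ => hC γ (hΔ hγ)) hconf hNIP hf
  exact ⟨h, fun hcof => h.of_cofinal hcof⟩
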